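/- Consider the following encounter of an ownship with a non-maneuvering intruder. The symbolic constants are real numbers $r_p,h_p$ (puck radius and half-height), $r_v$ (horizontal rate of closure), $a_{\text{lo}},a_{\text{up}}$ (advisory accelerations), $a_{\max}$ (acceleration limit of the ownship), $c$ and $\epsilon$; the state consists of the relative horizontal and vertical positions $r,h$, the relative climb rate $v$, the advisory $(w,v_{\text{lo}},v_{\text{up}})$, the ownship acceleration $a_o$ and a timer $t$. Define \begin{align*} T_{\text{lo}}(v,w,v_{\text{lo}}) &\equiv \tfrac{\max(0,w(v_{\text{lo}}-v))}{a_{\text{lo}}},\qquad T_{\text{up}}(v,w,v_{\text{up}}) \equiv \tfrac{\max(0,w(v_{\text{up}}-v))}{a_{\text{up}}},\\ A_{\text{lo}}(v,w,v_{\text{lo}},h_n,t) &\equiv \bigl(0\le t<T_{\text{lo}}\wedge h_n=\tfrac{wa_{\text{lo}}}{2}t^2+vt\bigr)\vee\bigl(t\ge T_{\text{lo}}\wedge h_n=v_{\text{lo}}t-\tfrac{w\max(0,w(v_{\text{lo}}-v))^2}{2a_{\text{lo}}}\bigr),\\ A_{\text{up}}(v,w,v_{\text{up}},h_n,t) &\equiv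 \bigl(0\le t<T_{\text{up}}\wedge h_n=\tfrac{wa_{\text{up}}}{2}t^2+vt\bigr)\vee\bigl(t\ge T_{\text{up}}\wedge h_n=w\max(wv_{\text{up}},wv)t-\tfrac{w\max(0,w(v_{\text{up}}-v))^2}{2a_{\text{up}}}\bigr),\\ L^{-1}(r,h,v,w,v_{\text{lo}}) &\equiv \forall t,r_n,h_n\,\bigl(r_n=r_vt\wedge A_{\text{lo}}(v,w,v_{\text{lo}},h_n,t)\to |r-r_n|>r_p\vee w(h_n-h)>h_p\bigr),\\ L^{\epsilon}(r,h,v,w,v_{\text{lo}}) &\equiv \forall t,r_n,h_n\,\bigl((t\le\epsilon\vee\epsilon<0)\wedge r_n=r_vt\wedge A_{\text{lo}}(v,w,v_{\text{lo}},h_n,t)\to |r-r_n|>r_p\vee w(h_n-h)>h_p\bigr),\\ U^{\epsilon}(r,h,v,w,v_{\text{up}}) &\equiv \forall t,r_n,h_n\,\bigl((t\le\epsilon\vee\epsilon<0)\wedge r_n=r_vt\wedge A_{\text{up}}(v,w,v_{\text{up}},h_n,t)\to |r-r_n|>r_p\vee w(h-h_n)>h_p\bigr). \end{align*} (Quotients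 by $a_{\text{up}}=0$, which under the conditions below can occur only if $c<0$, are read as $0$.) Let $L^{\text{safeable}(\epsilon)}(r,h,v,w,v_{\text{lo}})$ be the conjunction of $L^\epsilon(r,h,v,w,v_{\text{lo}})$ with: for all $h_1,v_1$, if $$\bigl(0\le\epsilon<T_{\text{lo}}\wedge h_1=\tfrac{wa_{\text{lo}}}{2}\epsilon^2+v\epsilon\wedge v_1=wa_{\text{lo}}\epsilon+v\bigr)\vee\bigl(\epsilon\ge T_{\text{lo}}\wedge h_1=v_1\epsilon-\tfrac{w\max(0,w(v_{\text{lo}}-v))^2}{2a_{\text{lo}}}\wedge v_1=v_{\text{lo}}\bigr),$$ then $\exists v'\,L^{-1}(r-r_v\epsilon,h-h_1,v_1,w,v')$. Let $U^{\text{safeable}(\epsilon)}(r,h,v,w,v_{\text{up}})$ be the conjunction of $U^\epsilon(r,h,v,w,v_{\text{up}})$ with: for all $h_1,v_1$, if $$\bigl(0\le\epsilon<T_{\text{up}}\wedge h_1=\tfrac{wa_{\text{up}}}{2}\epsilon^2+v\epsilon\wedge v_1=wa_{\text{up}}\epsilon+v\bigr)\vee\bigl(\epsilon\ge T_{\text{up}}\wedge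 h_1=v_1\epsilon-\tfrac{w\max(0,w(v_{\text{up}}-v))^2}{2a_{\text{up}}}\wedge v_1=w\max(wv_{\text{up}},wv)\bigr),$$ then $\exists v'\,L^{-1}(r-r_v\epsilon,h-h_1,v_1,-w,v')$. Finally let $$C^{\text{safeable}(\epsilon)}(r,h,v,w,v_{\text{lo}},v_{\text{up}})\equiv wv_{\text{lo}}\le wv_{\text{up}}\wedge\bigl(L^{\text{safeable}(\epsilon)}(r,h,v,w,v_{\text{lo}})\vee U^{\text{safeable}(\epsilon)}(r,h,v,w,v_{\text{up}})\bigr).$$ Let $\alpha$ be the hybrid game of differential game logic \begin{align*} \bigl(&(w:=1\cup w:=-1);\ v_{\text{lo}}:=*;\ v_{\text{up}}:=*;\ ?C^{\text{safeable}(\epsilon)}(r,h,v,w,v_{\text{lo}},v_{\text{up}});\ \text{advisory}:=(w,v_{\text{lo}},v_{\text{up}});\ t:=0;\\ &\bigl((a_o:=*;\ ?(-a_{\max}\le a_o\le a_{\max}))^d;\ (\beta_1\cup\beta_2)\bigr)^*\bigr)^* \end{align*} where $\beta_i$ is the differential equation system $r'=-r_v,\ h'=-v,\ v'=a_o,\ t'=1$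 restricted to the evolution domain $t\le\epsilon\wedge Q_i$, with $Q_1\equiv wa_o\le0\vee wv\le wv_{\text{up}}$ and $Q_2\equiv wa_o\ge0\wedge wv\ge wv_{\text{up}}$. The ownship (Demon) chooses $a_o$ in the game $(\cdot)^d$ and has to pass the test there; all other choices, including the advisories, the durations and the numbers of repetitions, belong to the opponent (Angel). Let $$\text{init}\equiv r_p\ge0\wedge h_p>0\wedge r_v\ge0\wedge a_{\text{lo}}>0\wedge(w=-1\vee w=1)\wedge a_{\text{up}}>a_{\text{lo}}+2c\wedge a_{\max}\ge a_{\text{lo}}\wedge\epsilon\ge0.$$ Theorem. (1) The formula $$\text{init}\wedge C^{\text{safeable}(\epsilon)}(r,h,v,w,v_{\text{lo}},v_{\text{up}})\to[\alpha]\,(|r|>r_p\vee|h|>h_p)$$ is valid: from every state satisfying the precondition the ownship has a strategy in $\alpha$ that avoids NMAC, whatever the opponent does. (2) If moreover $t=0$ initially, then the ownship has a strategy in $\alpha$ that avoids NMAC and guarantees in addition that, whenever the game ends with $t=\epsilon$, an infinite-time safe follow-up advisory exists, of the same sense or a reversal: $\exists v'\,L^{-1}(r,h,v,w,v')$ or $\exists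 v'\,L^{-1}(r,h,v,-w,v')$. -/

import Mathlib

/-! ## Differential game logic: hybrid games and the winning regions of Demon -/

namespace DGL

/-- A state assigns a real value to every variable. -/
abbrev State (V : Type) := V → ℝ

/-- Hybrid games over the variables `V`. Terms are real-valued functions of the state, and
formulas are sets of states. -/
inductive Game (V : Type) : Type
  /-- discrete assignment `x := e` -/
  | assign (x : V) (e : State V → ℝ)
  /-- nondeterministic assignment `x := *`, the value being chosen by Angel -/
  | assignAny (x : V)
  /-- test `?Q`, which Angel has to pass -/
  | test (Q : Set (State V))
  /-- differential equation system `{x₁' = e₁, …, xₙ' = eₙ & Q}`, with Angel choosing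
  the duration -/
  | ode (eqs : List (V × (State V → ℝ))) (Q : Set (State V))
  /-- `α ∪ β`, Angel choosing -/
  | choice (α β : Game V)
  /-- `α ; β` -/
  | seq (α β : Game V)
  /-- `α*`, Angel deciding after each round whether to go on -/
  | loop (α : Game V)
  /-- `αᵈ`, the game with the players swapped -/
  | dual (α : Game V)

/-- `φ` is a solution, of duration `T`, of the differential equations `eqs` with evolution domain
`Q`: the domain holds all along, the listed variables follow their equations (with one-sided
derivatives at the end points), and all other variables keep their values. -/
def IsSolution {V : Type} (eqs : List (V × (State V → ℝ))) (Q : Set (State V)) (T : ℝ)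
    (φ : ℝ → State V) : Prop :=
  ∀ τ ∈ Set.Icc 0 T,
    φ τ ∈ Q ∧
    (∀ p ∈ eqs, HasDerivWithinAt (fun σ => φ σ p.1) (p.2 (φ τ)) (Set.Icc 0 T) τ) ∧
    (∀ x, (∀ p ∈ eqs, p.1 ≠ x) → φ τ x = φ 0 x)

/-- `demonWins α X` is the set of states from which Demon has a winning strategy in the game `α`
to reach `X`, that is, the semantics of the box modality `[α] X`. -/
def demonWins {V : Type} [DecidableEq V] : Game V → Set (State V) → Set (State V)
  | .assign x e, X => {s | Function.update s x (e s) ∈ X}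
  | .assignAny x, X => {s | ∀ a : ℝ, Function.update s x a ∈ X}
  | .test Q, X => {s | s ∈ Q → s ∈ X}
  | .ode eqs Q, X =>
      {s | ∀ (T : ℝ) (φ : ℝ → State V), 0 ≤ T → IsSolution eqs Q T φ → φ 0 = s → φ T ∈ X}
  | .choice α β, X => demonWins α X ∩ demonWins β X
  | .seq α β, X => demonWins α (demonWins β X)
  | .loop α, X => ⋃₀ {Z | Z ⊆ X ∩ demonWins α Z}
  | .dual α, X => (demonWins α Xᶜ)ᶜ

/-- Validity of the formula `P → [α] Q`: it is true in every state. -/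
def ValidBox {V : Type} [DecidableEq V] (P : Set (State V)) (α : Game V) (Q : Set (State V)) :
    Prop :=
  ∀ s : State V, s ∈ P → s ∈ demonWins α Q

end DGL

/-! ## The collision avoidance model -/

namespace ACASX

open DGL

/-- The variables of the model: the symbolic constants
`rp` (puck radius), `hp` (puck half-height), `rv` (horizontal rate of closure),
`alo`, `aup` (lower and upper advisory accelerations), `amax` (ownship limit), `c`, `eps` (`ε`),
the relative position `r`, `h` and relative climb rate `v`,
the advisory in force `w`, `vlo`, `vup`, the three components of the issued `advisory`,
the acceleration `ao` of the ownship, and the timer `t`. -/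
inductive Var : Type
  | rp | hp | rv | alo | aup | amax | c | eps
  | r | h | v
  | w | vlo | vup
  | advisoryW | advisoryVlo | advisoryVup
  | ao | t
  deriving DecidableEq

/-- States of the model. In the formulas below the symbolic constants are read off from the state
`s`, while `r h v w vlo vup` are the arguments at which the formula is taken. -/
abbrev St := State Var

/-- `T_lo(v, w, v_lo)` -/
noncomputable def Tlo (s : St) (v w vlo : ℝ) : ℝ := max 0 (w * (vlo - v)) / s .alo

/-- `T_up(v, w, v_up)` -/
noncomputable def Tup (s : St) (v w vup : ℝ) : ℝ := max 0 (w * (vup - v)) / s .aup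

/-- `A_lo(v, w, v_lo, hn, t)`: at time `t` the lower nominal trajectory has height `hn`. -/
def Alo (s : St) (v w vlo hn t : ℝ) : Prop :=
  (0 ≤ t ∧ t < Tlo s v w vlo ∧ hn = w * s .alo / 2 * t ^ 2 + v * t) ∨
  (Tlo s v w vlo ≤ t ∧ hn = vlo * t - w * (max 0 (w * (vlo - v))) ^ 2 / (2 * s .alo))

/-- `A_up(v, w, v_up, hn, t)`: at time `t` the upper nominal trajectory has height `hn`. -/
def Aup (s : St) (v w vup hn t : ℝ) : Prop :=
  (0 ≤ t ∧ t < Tup s v w vup ∧ hn = w * s .aup / 2 * t ^ 2 + v * t) ∨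
  (Tup s v w vup ≤ t ∧
    hn = w * max (w * vup) (w * v) * t - w * (max 0 (w * (vup - v))) ^ 2 / (2 * s .aup))

/-- The infinite-time safe region `L⁻¹_impl(r, h, v, w, v_lo)`. -/
def LInf (s : St) (r h v w vlo : ℝ) : Prop :=
  ∀ t rn hn : ℝ, rn = s .rv * t ∧ Alo s v w vlo hn t →
    |r - rn| > s .rp ∨ w * (hn - h) > s .hp

/-- The bounded-time lower safe region `L^ε_impl(r, h, v, w, v_lo)`. -/
def LEps (s : St) (r h v w vlo : ℝ) : Prop :=
  ∀ t rn hn : ℝ, (t ≤ s .eps ∨ s .eps < 0) ∧ rn = s .rv * t ∧ Alo s v w vlo hn t →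
    |r - rn| > s .rp ∨ w * (hn - h) > s .hp

/-- The bounded-time upper safe region `U^ε_impl(r, h, v, w, v_up)`. -/
def UEps (s : St) (r h v w vup : ℝ) : Prop :=
  ∀ t rn hn : ℝ, (t ≤ s .eps ∨ s .eps < 0) ∧ rn = s .rv * t ∧ Aup s v w vup hn t →
    |r - rn| > s .rp ∨ w * (h - hn) > s .hp

/-- The lower safeable region `L^safeable(ε)_impl(r, h, v, w, v_lo)`; `hex` and `vex` are the height
and the climb rate at time `ε` on the lower nominal trajectory. -/
def LSafeable (s : St) (r h v w vlo : ℝ) : Prop :=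
  LEps s r h v w vlo ∧
  ∀ hex vex : ℝ,
    ((0 ≤ s .eps ∧ s .eps < Tlo s v w vlo ∧
        hex = w * s .alo / 2 * s .eps ^ 2 + v * s .eps ∧ vex = w * s .alo * s .eps + v) ∨
      (Tlo s v w vlo ≤ s .eps ∧
        hex = vex * s .eps - w * (max 0 (w * (vlo - v))) ^ 2 / (2 * s .alo) ∧ vex = vlo)) →
    ∃ vlo' : ℝ, LInf s (r - s .rv * s .eps) (h - hex) vex w vlo'

/-- The upper safeable region `U^safeable(ε)_impl(r, h, v, w, v_up)`; `hex` and `vex` are the height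
and the climb rate at time `ε` on the upper nominal trajectory. -/
def USafeable (s : St) (r h v w vup : ℝ) : Prop :=
  UEps s r h v w vup ∧
  ∀ hex vex : ℝ,
    ((0 ≤ s .eps ∧ s .eps < Tup s v w vup ∧
        hex = w * s .aup / 2 * s .eps ^ 2 + v * s .eps ∧ vex = w * s .aup * s .eps + v) ∨
      (Tup s v w vup ≤ s .eps ∧
        hex = vex * s .eps - w * (max 0 (w * (vup - v))) ^ 2 / (2 * s .aup) ∧
        vex = w * max (w * vup) (w * v))) →
    ∃ vup' : ℝ, LInf s (r - s .rv * s .eps) (h - hex) vex (-w) vup'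

/-- The two-sided safeable region `C^safeable(ε)_impl(r, h, v, w, v_lo, v_up)`. -/
def CSafeable (s : St) (r h v w vlo vup : ℝ) : Prop :=
  w * vlo ≤ w * vup ∧ (LSafeable s r h v w vlo ∨ USafeable s r h v w vup)

/-- The formula `C^safeable(ε)_impl` at the current values of the variables. -/
def safeableRegion : Set St :=
  {s | CSafeable s (s .r) (s .h) (s .v) (s .w) (s .vlo) (s .vup)}

/-- The initial conditions on the parameters. -/
def init : Set St :=
  {s | s .rp ≥ 0 ∧ s .hp > 0 ∧ s .rv ≥ 0 ∧ s .alo > 0 ∧ (s .w = -1 ∨ s .w = 1) ∧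
    s .aup > s .alo + 2 * s .c ∧ s .amax ≥ s .alo ∧ s .eps ≥ 0}

/-- No near mid-air collision: `|r| > rp ∨ |h| > hp`. -/
def noNMAC : Set St := {s | |s .r| > s .rp ∨ |s .h| > s .hp}

/-- Angel issues an arbitrary advisory in the safeable region:
`(w := 1 ∪ w := -1); vlo := *; vup := *; ?C; advisory := (w, vlo, vup)`. -/
def issueAdvisory : Game Var :=
  .seq (.choice (.assign .w fun _ => 1) (.assign .w fun _ => -1)) <|
  .seq (.assignAny .vlo) <|
  .seq (.assignAny .vup) <|
  .seq (.test safeableRegion) <|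
  .seq (.assign .advisoryW fun s => s .w) <|
  .seq (.assign .advisoryVlo fun s => s .vlo) <|
  .assign .advisoryVup fun s => s .vup

/-- The ownship (Demon) picks its acceleration: `(ao := *; ?(-amax ≤ ao ≤ amax))ᵈ`. -/
def ownship : Game Var :=
  .dual (.seq (.assignAny .ao) (.test {s | -s .amax ≤ s .ao ∧ s .ao ≤ s .amax}))

/-- `r' = -rv, h' = -v, v' = ao, t' = 1` -/
def dynamics : List (Var × (St → ℝ)) :=
  [(.r, fun s => -s .rv), (.h, fun s => -s .v), (.v, fun s => s .ao), (.t, fun _ => 1)]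

/-- The motion, with overlapping evolution domains for the detection of the event `w v = w vup`:
a choice between two differential equation systems that differ only in the evolution domain. -/
def motion : Game Var :=
  .choice
    (.ode dynamics {s | s .t ≤ s .eps ∧ (s .w * s .ao ≤ 0 ∨ s .w * s .v ≤ s .w * s .vup)})
    (.ode dynamics {s | s .t ≤ s .eps ∧ (s .w * s .ao ≥ 0 ∧ s .w * s .v ≥ s .w * s .vup)})

/-- The hybrid game `(issueAdvisory; t := 0; (ownship; motion)*)*`. -/
def safeableGame : Game Var :=
  .loop <| .seq issueAdvisory <| .seq (.assign .t fun _ => 0) <| .loop (.seq ownship motion)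

/-- If the time bound `ε` is reached, there is an infinite-time safe follow-up advisory, of the
same sense `w` (such as a strengthening) or of the opposite sense `-w` (a reversal). -/
def followUpExists : Set St :=
  {s | s .t = s .eps →
    (∃ vlo' : ℝ, LInf s (s .r) (s .h) (s .v) (s .w) vlo') ∨
    (∃ vlo' : ℝ, LInf s (s .r) (s .h) (s .v) (-s .w) vlo')}

end ACASX

/-! The ownship needs no feedback. When an advisory is issued, it fixes a constant acceleration: `w
* alo` if the lower safeable region holds, and `0` otherwise, when the upper one does. Measured in
the sense `w`, full acceleration never falls below the lower nominal trajectory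
(`Alo.le_accelerate`), and a constant climb rate never rises above the upper one (`Aup.ge_level`).
The clearance promised for the nominal trajectories therefore carries over up to time `ε`. At time
`ε` the actual height and climb rate are at least as favourable as the nominal ones, in the sense
`w` or `-w` respectively. Since infinite-time safe regions are monotone in both (`LInf.mono`, from
`Alo.mono`), the nominal follow-up advisory still works. The game argument uses two nested
invariants: `onCourse` for the inner loop, and `init` together with the postcondition for the outer
one. -/

namespace DGL

variable {V : Type} [DecidableEq V]

/-- Loop rule: an invariant on which Demon wins is contained in the winning region of the loop. -/
theorem mem_demonWins_loop {α : Game V} {X Z : Set (State V)} (hX : Z ⊆ X)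
    (hZ : Z ⊆ demonWins α Z) : Z ⊆ demonWins (.loop α) X :=
  fun _ hs => Set.mem_sUnion.2 ⟨Z, fun _ hx => ⟨hX hx, hZ hx⟩, hs⟩

end DGL

namespace ACASX

open DGL Set

/-! ### Explicit solutions of the motion -/

/-- Two functions with the same derivative on `[0, T]` have the same increment. -/
theorem sub_eq_sub_of_hasDerivWithinAt {f g f' : ℝ → ℝ} {T : ℝ} (hT : 0 ≤ T)
    (hf : ∀ τ ∈ Icc 0 T, HasDerivWithinAt f (f' τ) (Icc 0 T) τ)
    (hg : ∀ τ ∈ Icc 0 T, HasDerivWithinAt g (f' τ) (Icc 0 T) τ) {τ : ℝ} (hτ : τ ∈ Icc 0 T) :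
    f τ - g τ = f 0 - g 0 := by
  have hd : ∀ τ ∈ Icc 0 T, HasDerivWithinAt (fun σ => f σ - g σ) 0 (Icc 0 T) τ := fun τ h => by
    simpa using (hf τ h).fun_sub (hg τ h)
  -- Derivatives within a one-point interval are not unique, so `T = 0` is separate.
  rcases hT.eq_or_lt with rfl | hT
  · have : τ = 0 := le_antisymm hτ.2 hτ.1
    rw [this]
  · exact constant_of_derivWithin_zero (fun x hx => (hd x hx).differentiableWithinAt)
      (fun x hx => (hd x ⟨hx.1, hx.2.le⟩).derivWithin
        (uniqueDiffOn_Icc hT x ⟨hx.1, hx.2.le⟩)) τ hτ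

/-- The solutions of the equations of motion. -/
theorem dynamics_solution {Q : Set St} {T : ℝ} {φ : ℝ → St} (hT : 0 ≤ T)
    (hφ : IsSolution dynamics Q T φ) :
    φ T .r = φ 0 .r - φ 0 .rv * T ∧ φ T .t = φ 0 .t + T ∧ φ T .v = φ 0 .v + φ 0 .ao * T ∧
    φ T .h = φ 0 .h - φ 0 .v * T - φ 0 .ao / 2 * T ^ 2 ∧
    ∀ x : Var, x ≠ .r → x ≠ .h → x ≠ .v → x ≠ .t → φ T x = φ 0 x := by
  have hconst : ∀ τ ∈ Icc 0 T, ∀ x : Var, x ≠ .r → x ≠ .h → x ≠ .v → x ≠ .t →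
      φ τ x = φ 0 x := fun τ hτ x h1 h2 h3 h4 =>
    (hφ τ hτ).2.2 x (by simp [dynamics, h1.symm, h2.symm, h3.symm, h4.symm])
  have hTT : T ∈ Icc 0 T := ⟨hT, le_rfl⟩
  have hlin : ∀ (a τ : ℝ), HasDerivWithinAt (fun σ => a * σ) a (Icc 0 T) τ := fun a τ => by
    simpa using (hasDerivWithinAt_id τ (Icc 0 T)).const_mul a
  have hr := sub_eq_sub_of_hasDerivWithinAt (f := fun τ => φ τ .r) (g := fun τ => -φ 0 .rv * τ)
    (f' := fun _ => -φ 0 .rv) hT (fun τ hτ => by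
      have := (hφ τ hτ).2.1 (.r, fun s => -s .rv) (by simp [dynamics])
      simpa [hconst τ hτ .rv] using this) (fun τ _ => hlin _ τ) hTT
  have ht := sub_eq_sub_of_hasDerivWithinAt (f := fun τ => φ τ .t) (g := fun τ => 1 * τ)
    (f' := fun _ => 1) hT (fun τ hτ => by
      simpa using (hφ τ hτ).2.1 (.t, fun _ => 1) (by simp [dynamics])) (fun τ _ => hlin _ τ) hTT
  have hv : ∀ τ ∈ Icc 0 T, φ τ .v = φ 0 .v + φ 0 .ao * τ := fun τ hτ => by
    have := sub_eq_sub_of_hasDerivWithinAt (f := fun τ => φ τ .v) (g := fun τ => φ 0 .ao * τ)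
      (f' := fun _ => φ 0 .ao) hT (fun τ hτ => by
        have := (hφ τ hτ).2.1 (.v, fun s => s .ao) (by simp [dynamics])
        simpa [hconst τ hτ .ao] using this) (fun τ _ => hlin _ τ) hτ
    linarith
  have hh := sub_eq_sub_of_hasDerivWithinAt (f := fun τ => φ τ .h)
    (g := fun τ => -φ 0 .v * τ - φ 0 .ao / 2 * τ ^ 2)
    (f' := fun τ => -(φ 0 .v + φ 0 .ao * τ)) hT (fun τ hτ => by
      have := (hφ τ hτ).2.1 (.h, fun s => -s .v) (by simp [dynamics])
      simp only [hv τ hτ] at this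
      exact this) (fun τ _ => by
      have h2 : HasDerivWithinAt (fun σ : ℝ => φ 0 .ao / 2 * σ ^ 2) (φ 0 .ao / 2 * (2 * τ))
          (Icc 0 T) τ := by
        simpa using ((hasDerivAt_pow 2 τ).const_mul (φ 0 .ao / 2)).hasDerivWithinAt
      exact ((hlin (-φ 0 .v) τ).fun_sub h2).congr_deriv (by ring)) hTT
  exact ⟨by linarith, by linarith, hv T hTT, by linarith, hconst T hTT⟩

/-! ### Comparison of nominal trajectories -/

theorem Alo_exists (s : St) (v w vlo : ℝ) {t : ℝ} (ht : 0 ≤ t) : ∃ hn, Alo s v w vlo hn t := by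
  rcases lt_or_ge t (Tlo s v w vlo) with h | h
  · exact ⟨_, .inl ⟨ht, h, rfl⟩⟩
  · exact ⟨_, .inr ⟨h, rfl⟩⟩

theorem Aup_exists (s : St) (v w vup : ℝ) {t : ℝ} (ht : 0 ≤ t) : ∃ hn, Aup s v w vup hn t := by
  rcases lt_or_ge t (Tup s v w vup) with h | h
  · exact ⟨_, .inl ⟨ht, h, rfl⟩⟩
  · exact ⟨_, .inr ⟨h, rfl⟩⟩

/-- The second clause of `Alo` does not demand `0 ≤ t`; it follows from `Tlo ≥ 0`. -/
theorem Alo.nonneg {s : St} {v w vlo hn t : ℝ} (ha : 0 < s .alo) (h : Alo s v w vlo hn t) :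
    0 ≤ t := by
  rcases h with h | h
  · exact h.1
  · exact (div_nonneg (le_max_left _ _) ha.le).trans h.1

/-- The lower nominal trajectory stays below the one that accelerates all the time. -/
theorem Alo.le_accelerate {s : St} {v w vlo hn t : ℝ} (ha : 0 < s .alo) (hw : w = -1 ∨ w = 1)
    (h : Alo s v w vlo hn t) : w * hn ≤ w * v * t + s .alo / 2 * t ^ 2 := by
  have hww : w * w = 1 := by rcases hw with rfl | rfl <;> norm_num
  have ht := h.nonneg ha
  rcases h with ⟨-, -, rfl⟩ | ⟨-, rfl⟩
  · exact le_of_eq (by linear_combination s .alo / 2 * t ^ 2 * hww)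
  · set d := max 0 (w * (vlo - v))
    have hd : w * (vlo - v) ≤ d := le_max_right _ _
    have hdt : w * (vlo - v) * t ≤ d * t := mul_le_mul_of_nonneg_right hd ht
    have e : w * (vlo * t - w * d ^ 2 / (2 * s .alo)) = w * vlo * t - d ^ 2 / (2 * s .alo) := by
      linear_combination (-d ^ 2 / (2 * s .alo)) * hww
    -- Completing the square, with equality when the climb-rate deficit `d` is exactly `alo * t`.
    have hsq : d * t ≤ s .alo / 2 * t ^ 2 + d ^ 2 / (2 * s .alo) := by
      have : s .alo / 2 * t ^ 2 + d ^ 2 / (2 * s .alo) - d * t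
          = (s .alo * t - d) ^ 2 / (2 * s .alo) := by field_simp; ring
      have h0 : 0 ≤ (s .alo * t - d) ^ 2 / (2 * s .alo) := by positivity
      linarith
    rw [e]
    linarith

/-- The upper nominal trajectory stays above the one that keeps the climb rate. -/
theorem Aup.ge_level {s : St} {v w vup hn t : ℝ} (hw : w = -1 ∨ w = 1) (ht : 0 ≤ t)
    (h : Aup s v w vup hn t) : w * v * t ≤ w * hn := by
  have hww : w * w = 1 := by rcases hw with rfl | rfl <;> norm_num
  rcases h with ⟨-, h, rfl⟩ | ⟨h, rfl⟩
  -- A negative `aup` would make `Tup ≤ 0`, leaving no time for the acceleration phase.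
  · have ha : 0 ≤ s .aup := by
      by_contra! ha
      exact (ht.trans_lt h).not_ge (div_nonpos_of_nonneg_of_nonpos (le_max_left _ _) ha.le)
    have h0 : 0 ≤ s .aup / 2 * t ^ 2 := by positivity
    linear_combination h0 - s .aup / 2 * t ^ 2 * hww
  · unfold Tup at h
    have e : max (w * vup) (w * v) = w * v + max 0 (w * (vup - v)) := by
      rw [max_comm, ← max_add_add_left]; ring_nf
    rw [e]
    set d := max 0 (w * (vup - v))
    have hd : 0 ≤ d := le_max_left _ _
    have e : w * (w * (w * v + d) * t - w * d ^ 2 / (2 * s .aup))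
        = w * v * t + d * t - d ^ 2 / (2 * s .aup) := by
      linear_combination ((w * v + d) * t - d ^ 2 / (2 * s .aup)) * hww
    rw [e]
    have hdt : 0 ≤ d * t := mul_nonneg hd ht
    -- For `aup ≤ 0` the subtracted quotient is nonpositive (zero at `aup = 0`); otherwise `d / aup
    -- ≤ t` gives `d² / aup ≤ d * t`.
    rcases le_or_gt (s .aup) 0 with ha | ha
    · have : d ^ 2 / (2 * s .aup) ≤ 0 :=
        div_nonpos_of_nonneg_of_nonpos (sq_nonneg d) (by linarith)
      linarith
    · have : d ^ 2 / (2 * s .aup) = d / s .aup * d / 2 := by field_simp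
      have := mul_le_mul_of_nonneg_right h hd
      linarith

/-- The lower nominal trajectory is monotone in the initial climb rate. -/
theorem Alo.mono {s : St} {v₁ v₂ w vlo h₁ h₂ t : ℝ} (ha : 0 < s .alo) (hw : w = -1 ∨ w = 1)
    (hv : w * v₁ ≤ w * v₂) (A₁ : Alo s v₁ w vlo h₁ t) (A₂ : Alo s v₂ w vlo h₂ t) :
    w * h₁ ≤ w * h₂ := by
  have hww : w * w = 1 := by rcases hw with rfl | rfl <;> norm_num
  have ht := A₁.nonneg ha
  have hlin : w * v₁ * t ≤ w * v₂ * t := mul_le_mul_of_nonneg_right hv ht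
  have hle := A₁.le_accelerate ha hw
  have hd : max 0 (w * (vlo - v₂)) ≤ max 0 (w * (vlo - v₁)) :=
    max_le_max le_rfl (by linarith)
  rcases A₂ with ⟨-, -, rfl⟩ | ⟨hT₂, rfl⟩
  · linear_combination hle + hlin - s .alo / 2 * t ^ 2 * hww
  · have e₂ : w * (vlo * t - w * max 0 (w * (vlo - v₂)) ^ 2 / (2 * s .alo))
        = w * vlo * t - max 0 (w * (vlo - v₂)) ^ 2 / (2 * s .alo) := by
      linear_combination (-max 0 (w * (vlo - v₂)) ^ 2 / (2 * s .alo)) * hww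
    rw [e₂]
    have hd₂ : 0 ≤ max 0 (w * (vlo - v₂)) := le_max_left _ _
    rcases A₁ with ⟨-, hT₁, rfl⟩ | ⟨-, rfl⟩
    -- Here `alo * t` lies between the two deficits: at least `d₂`, and below `w * (vlo - v₁)`.
    · unfold Tlo at hT₁ hT₂
      rw [div_le_iff₀ ha] at hT₂
      rw [lt_div_iff₀ ha] at hT₁
      set d₂ := max 0 (w * (vlo - v₂))
      have hsq : d₂ ^ 2 / (2 * s .alo) ≤ s .alo / 2 * t ^ 2 := by
        rw [div_le_iff₀ (by positivity)]
        have := pow_le_pow_left₀ hd₂ hT₂ 2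
        linear_combination this
      have h₁ : t * s .alo < w * (vlo - v₁) := by
        rcases lt_max_iff.1 hT₁ with h | h
        · exact absurd h (not_lt.2 (by positivity))
        · exact h
      have := mul_le_mul_of_nonneg_right h₁.le ht
      linear_combination this + hsq + s .alo / 2 * t ^ 2 * hww
    · have e₁ : w * (vlo * t - w * max 0 (w * (vlo - v₁)) ^ 2 / (2 * s .alo))
          = w * vlo * t - max 0 (w * (vlo - v₁)) ^ 2 / (2 * s .alo) := by
        linear_combination (-max 0 (w * (vlo - v₁)) ^ 2 / (2 * s .alo)) * hww
      rw [e₁]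
      gcongr

/-- The infinite-time safe region of sense `w` is closed under a larger climb rate and a lower
intruder, both measured in the sense `w`. -/
theorem LInf.mono {s : St} {r h₁ h₂ v₁ v₂ w vlo : ℝ} (ha : 0 < s .alo) (hw : w = -1 ∨ w = 1)
    (hv : w * v₁ ≤ w * v₂) (hh : w * h₂ ≤ w * h₁) (H : LInf s r h₁ v₁ w vlo) :
    LInf s r h₂ v₂ w vlo := by
  rintro t rn hn ⟨hr, A⟩
  obtain ⟨hn₁, A₁⟩ := Alo_exists s v₁ w vlo (A.nonneg ha)
  refine (H t rn hn₁ ⟨hr, A₁⟩).imp_right fun h => ?_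
  have := A₁.mono ha hw hv A
  rw [mul_sub] at h ⊢
  linarith

theorem lt_abs_of_sense {w h b : ℝ} (hw : w = -1 ∨ w = 1) (H : b < w * h ∨ b < -(w * h)) :
    b < |h| := by
  rw [lt_abs]
  rcases hw with rfl | rfl <;> simpa [or_comm] using H

/-! ### Safety and follow-up for the two constant accelerations -/

/-- Accelerating all the time from the lower safeable region avoids NMAC up to time `ε`. -/
theorem LSafeable.safe {s : St} {r h v w vlo t : ℝ} (ha : 0 < s .alo) (hw : w = -1 ∨ w = 1)
    (H : LSafeable s r h v w vlo) (ht : 0 ≤ t) (hte : t ≤ s .eps) :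
    |r - s .rv * t| > s .rp ∨ |h - v * t - w * s .alo / 2 * t ^ 2| > s .hp := by
  obtain ⟨hn, A⟩ := Alo_exists s v w vlo ht
  refine (H.1 t _ hn ⟨.inl hte, rfl, A⟩).imp_right fun h' => lt_abs_of_sense hw (.inr ?_)
  have hww : w * w = 1 := by rcases hw with rfl | rfl <;> norm_num
  linear_combination h' + A.le_accelerate ha hw - s .alo / 2 * t ^ 2 * hww

/-- Keeping the climb rate from the upper safeable region avoids NMAC up to time `ε`. -/
theorem USafeable.safe {s : St} {r h v w vup t : ℝ} (hw : w = -1 ∨ w = 1)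
    (H : USafeable s r h v w vup) (ht : 0 ≤ t) (hte : t ≤ s .eps) :
    |r - s .rv * t| > s .rp ∨ |h - v * t| > s .hp := by
  obtain ⟨hn, A⟩ := Aup_exists s v w vup ht
  refine (H.1 t _ hn ⟨.inl hte, rfl, A⟩).imp_right fun h' => lt_abs_of_sense hw (.inl ?_)
  linear_combination h' + A.ge_level hw ht

/-- Accelerating up to time `ε` from the lower safeable region leaves a safe advisory of the same
sense. -/
theorem LSafeable.followUp {s : St} {r h v w vlo : ℝ} (ha : 0 < s .alo) (hw : w = -1 ∨ w = 1)
    (he : 0 ≤ s .eps) (H : LSafeable s r h v w vlo) :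
    ∃ vlo', LInf s (r - s .rv * s .eps) (h - v * s .eps - w * s .alo / 2 * s .eps ^ 2)
      (v + w * s .alo * s .eps) w vlo' := by
  have hww : w * w = 1 := by rcases hw with rfl | rfl <;> norm_num
  rcases lt_or_ge (s .eps) (Tlo s v w vlo) with h' | h'
  · obtain ⟨vlo', hL⟩ := H.2 _ _ (.inl ⟨he, h', rfl, rfl⟩)
    refine ⟨vlo', hL.mono ha hw (le_of_eq ?_) (le_of_eq ?_)⟩ <;> ring
  · obtain ⟨vlo', hL⟩ := H.2 _ _ (.inr ⟨h', rfl, rfl⟩)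
    refine ⟨vlo', hL.mono ha hw ?_ ?_⟩
    -- Since `Tlo ≤ ε`, full acceleration has reached or passed `vlo` by time `ε`.
    · have := (div_le_iff₀ ha).1 h'
      have := (le_max_right 0 (w * (vlo - v))).trans this
      linear_combination this - s .alo * s .eps * hww
    · have A : Alo s v w vlo _ (s .eps) := .inr ⟨h', rfl⟩
      linear_combination A.le_accelerate ha hw - s .alo / 2 * s .eps ^ 2 * hww

/-- Keeping the climb rate up to time `ε` from the upper safeable region leaves a safe reversal. -/
theorem USafeable.followUp {s : St} {r h v w vup : ℝ} (ha : 0 < s .alo) (hw : w = -1 ∨ w = 1)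
    (he : 0 ≤ s .eps) (H : USafeable s r h v w vup) :
    ∃ vlo', LInf s (r - s .rv * s .eps) (h - v * s .eps) v (-w) vlo' := by
  have hww : w * w = 1 := by rcases hw with rfl | rfl <;> norm_num
  have hw' : -w = -1 ∨ -w = 1 := by rcases hw with rfl | rfl <;> simp
  rcases lt_or_ge (s .eps) (Tup s v w vup) with h' | h'
  · have A : Aup s v w vup _ (s .eps) := .inl ⟨he, h', rfl⟩
    obtain ⟨vlo', hL⟩ := H.2 _ _ (.inl ⟨he, h', rfl, rfl⟩)
    have hup : 0 ≤ s .aup := by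
      by_contra! hup
      exact (he.trans_lt h').not_ge (div_nonpos_of_nonneg_of_nonpos (le_max_left _ _) hup.le)
    refine ⟨vlo', hL.mono ha hw' ?_ ?_⟩
    · linear_combination mul_nonneg hup he - s .aup * s .eps * hww
    · linear_combination A.ge_level hw he
  · have A : Aup s v w vup _ (s .eps) := .inr ⟨h', rfl⟩
    obtain ⟨vlo', hL⟩ := H.2 _ _ (.inr ⟨h', rfl, rfl⟩)
    refine ⟨vlo', hL.mono ha hw' ?_ ?_⟩
    -- In the sense `w` the nominal exit rate is at least `v`; in the sense `-w` the order reverses,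
    -- as monotonicity requires.
    · linear_combination le_max_right (w * vup) (w * v) - max (w * vup) (w * v) * hww
    · linear_combination A.ge_level hw he

/-! ### The invariant of the inner loop -/

/-- The variables that do not change while an advisory is in force. -/
def Var.IsFixed (x : Var) : Prop := x ≠ .r ∧ x ≠ .h ∧ x ≠ .v ∧ x ≠ .t ∧ x ≠ .ao

/-- The states reached by constant acceleration from a state `s₀` in which a safeable advisory has
been issued: full acceleration in the sense of the advisory if the lower safeable region holds, and
no acceleration if the upper one does. -/
def onCourse : Set St :=
  {s | ∃ s₀ ∈ init, ∃ a : ℝ,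
    (LSafeable s₀ (s₀ .r) (s₀ .h) (s₀ .v) (s₀ .w) (s₀ .vlo) ∧ a = s₀ .w * s₀ .alo ∨
      USafeable s₀ (s₀ .r) (s₀ .h) (s₀ .v) (s₀ .w) (s₀ .vup) ∧ a = 0) ∧
    (∀ x : Var, x.IsFixed → s x = s₀ x) ∧ 0 ≤ s .t ∧ s .t ≤ s .eps ∧
    s .r = s₀ .r - s₀ .rv * s .t ∧ s .v = s₀ .v + a * s .t ∧
    s .h = s₀ .h - s₀ .v * s .t - a / 2 * s .t ^ 2}

theorem constants_congr {s s₀ : St} (h : ∀ x : Var, x.IsFixed → s x = s₀ x) :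
    s .rp = s₀ .rp ∧ s .hp = s₀ .hp ∧ s .rv = s₀ .rv ∧ s .alo = s₀ .alo ∧ s .aup = s₀ .aup ∧
    s .amax = s₀ .amax ∧ s .c = s₀ .c ∧ s .eps = s₀ .eps ∧ s .w = s₀ .w := by
  refine ⟨?_, ?_, ?_, ?_, ?_, ?_, ?_, ?_, ?_⟩ <;> exact h _ (by simp [Var.IsFixed])

theorem mem_init_congr {s s₀ : St} (h : ∀ x : Var, x.IsFixed → s x = s₀ x) (hs : s₀ ∈ init) :
    s ∈ init := by
  obtain ⟨e1, e2, e3, e4, e5, e6, e7, e8, e9⟩ := constants_congr h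
  simpa only [init, mem_ofPred_eq, e1, e2, e3, e4, e5, e6, e7, e8, e9] using hs

theorem LInf_congr {s s₀ : St} (h : ∀ x : Var, x.IsFixed → s x = s₀ x) (r h' v w vlo : ℝ) :
    LInf s r h' v w vlo ↔ LInf s₀ r h' v w vlo := by
  obtain ⟨e1, e2, e3, e4, -⟩ := constants_congr h
  simp only [LInf, Alo, Tlo, e1, e2, e3, e4]

theorem onCourse_subset : onCourse ⊆ init ∩ (noNMAC ∩ followUpExists) := by
  rintro s ⟨s₀, hi, a, hsafe, hfix, ht, hte, hr, hv, hh⟩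
  have hi' := hi
  obtain ⟨-, -, -, ha, hw, -, -, he⟩ := hi'
  obtain ⟨erp, ehp, -, -, -, -, -, ee, ew⟩ := constants_congr hfix
  rw [ee] at hte
  refine ⟨mem_init_congr hfix hi, ?_, fun hT => ?_⟩
  · change _ ∨ _
    rw [erp, ehp, hr, hh]
    rcases hsafe with ⟨H, rfl⟩ | ⟨H, rfl⟩
    · exact H.safe ha hw ht hte
    · simpa using H.safe hw ht hte
  · simp only [LInf_congr hfix, ew, hr, hv, hh, hT, ee]
    rcases hsafe with ⟨H, rfl⟩ | ⟨H, rfl⟩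
    · exact .inl (H.followUp ha hw he)
    · right
      simpa using H.followUp ha hw he

theorem onCourse_of_safeable {s : St} (hi : s ∈ init) (hC : s ∈ safeableRegion) (ht : s .t = 0) :
    s ∈ onCourse := by
  have he : 0 ≤ s .eps := hi.2.2.2.2.2.2.2
  rcases hC.2 with H | H
  · exact ⟨s, hi, _, .inl ⟨H, rfl⟩, fun _ _ => rfl, by simp [ht, he]⟩
  · exact ⟨s, hi, _, .inr ⟨H, rfl⟩, fun _ _ => rfl, by simp [ht, he]⟩

/-- Motion with the same acceleration `a` continues the same parabola from `s₀`. Only the timer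
bound of the evolution domain matters, so both branches of `motion` are covered. -/
theorem onCourse_of_solution {s s₀ : St} {Q : Set St} {a T : ℝ} {φ : ℝ → St} (hT : 0 ≤ T)
    (hi : s₀ ∈ init)
    (hsafe : LSafeable s₀ (s₀ .r) (s₀ .h) (s₀ .v) (s₀ .w) (s₀ .vlo) ∧ a = s₀ .w * s₀ .alo ∨
      USafeable s₀ (s₀ .r) (s₀ .h) (s₀ .v) (s₀ .w) (s₀ .vup) ∧ a = 0)
    (hfix : ∀ x : Var, x.IsFixed → s x = s₀ x) (ht : 0 ≤ s .t)
    (hr : s .r = s₀ .r - s₀ .rv * s .t) (hv : s .v = s₀ .v + a * s .t)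
    (hh : s .h = s₀ .h - s₀ .v * s .t - a / 2 * s .t ^ 2)
    (hQ : Q ⊆ {s | s .t ≤ s .eps}) (hφ : IsSolution dynamics Q T φ)
    (h0 : φ 0 = Function.update s .ao a) : φ T ∈ onCourse := by
  obtain ⟨er, et, ev, eh, ec⟩ := dynamics_solution hT hφ
  have erv : s .rv = s₀ .rv := hfix _ (by simp [Var.IsFixed])
  simp only [h0, ne_eq, reduceCtorEq, not_false_eq_true, Function.update_of_ne,
    Function.update_self, erv] at er et ev eh
  refine ⟨s₀, hi, a, hsafe, fun x hx => ?_, by linarith, hQ (hφ T ⟨hT, le_rfl⟩).1, ?_, ?_, ?_⟩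
  · obtain ⟨h1, h2, h3, h4, h5⟩ := hx
    rw [ec x h1 h2 h3 h4, h0, Function.update_of_ne h5, hfix x ⟨h1, h2, h3, h4, h5⟩]
  · rw [er, et, hr]; ring
  · rw [ev, et, hv]; ring
  · rw [eh, et, hh, hv]; ring

theorem onCourse_invariant : onCourse ⊆ demonWins (.seq ownship motion) onCourse := by
  rintro s ⟨s₀, hi, a, hsafe, hfix, ht, -, hr, hv, hh⟩
  obtain ⟨-, -, -, ha, hw, -, hmax, -⟩ := id hi
  have emax : s .amax = s₀ .amax := hfix _ (by simp [Var.IsFixed])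
  have hbound : -s .amax ≤ a ∧ a ≤ s .amax := by
    rw [emax]
    rcases hsafe with ⟨-, rfl⟩ | ⟨-, rfl⟩
    · rcases hw with h | h <;> rw [h] <;> constructor <;> linarith
    · constructor <;> linarith
  -- By duality, Demon wins once some admissible acceleration refutes `hlose`; the witness is the
  -- `a` stored in the invariant.
  refine fun hlose => hlose a (by simpa using hbound) ⟨fun T φ hT hφ h0 => ?_, fun T φ hT hφ h0 => ?_⟩
  · exact onCourse_of_solution hT hi hsafe hfix ht hr hv hh (fun _ h => h.1) hφ h0
  · exact onCourse_of_solution hT hi hsafe hfix ht hr hv hh (fun _ h => h.1) hφ h0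

/-! ### Winning the game -/

/-- Once a safeable advisory is issued and the timer reset, the ownship is on course. -/
theorem init_subset_issueAdvisory {Y : Set St} (hY : onCourse ⊆ Y) :
    init ⊆ demonWins issueAdvisory (demonWins (.assign .t fun _ => 0) Y) := by
  intro s hi
  obtain ⟨h1, h2, h3, h4, -, h6, h7, h8⟩ := hi
  exact ⟨fun vlo vup hC => hY (onCourse_of_safeable ⟨h1, h2, h3, h4, .inr rfl, h6, h7, h8⟩ hC rfl),
    fun vlo vup hC => hY (onCourse_of_safeable ⟨h1, h2, h3, h4, .inl rfl, h6, h7, h8⟩ hC rfl)⟩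

/-- The ownship wins for every postcondition implied by its invariant. -/
theorem init_inter_subset_safeableGame {X : Set St} (hX : noNMAC ∩ followUpExists ⊆ X) :
    init ∩ X ⊆ demonWins safeableGame X := by
  -- Every new advisory restarts the argument, so the outer invariant need not remember the previous
  -- course.
  refine mem_demonWins_loop inter_subset_right fun s hs => ?_
  exact init_subset_issueAdvisory (mem_demonWins_loop
    (onCourse_subset.trans (inter_subset_inter_right _ hX)) onCourse_invariant) hs.1

/-- Angel may stop before the first round, so the initial state itself must be free of NMAC: this is
safety at time `0`. -/
theorem noNMAC_of_safeable {s : St} (hi : s ∈ init) (hC : s ∈ safeableRegion) : s ∈ noNMAC := by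
  obtain ⟨-, -, -, ha, hw, -, -, he⟩ := hi
  rcases hC.2 with H | H
  · simpa [noNMAC] using H.safe ha hw le_rfl he
  · simpa [noNMAC] using H.safe hw le_rfl he

end ACASX

theorem theorem6 :
    DGL.ValidBox (ACASX.init ∩ ACASX.safeableRegion) ACASX.safeableGame ACASX.noNMAC ∧
    DGL.ValidBox (ACASX.init ∩ ACASX.safeableRegion ∩ {s | s .t = 0}) ACASX.safeableGame
      (ACASX.noNMAC ∩ ACASX.followUpExists) :=
  ⟨fun _ hs => ACASX.init_inter_subset_safeableGame Set.inter_subset_left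
      ⟨hs.1, ACASX.noNMAC_of_safeable hs.1 hs.2⟩,
    -- With `t = 0` the initial state is already on course, which also gives the follow-up if Angel
    -- stops at once and `ε = 0`.
    fun _ hs => ACASX.init_inter_subset_safeableGame subset_rfl
      ⟨hs.1.1, (ACASX.onCourse_subset (ACASX.onCourse_of_safeable hs.1.1 hs.1.2 hs.2)).2⟩⟩
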